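/- Conventions. For a finite graph $G$ (multiple edges and loops allowed) let $\deg(v)$ be the degree of $v$, where edges are counted with multiplicity and loops are counted twice; for a set $A$ of vertices let $e(A)$ be the number of edges with both ends in $A$ (loops included). The modularity of $G$ is $$q^*(G)=\max_{\mathcal A}\sum_{A\in\mathcal A}\left(\frac{e(A)}{|E(G)|}-\frac{\big(\sum_{v\in A}\deg(v)\big)^2}{4|E(G)|^2}\right),$$ where the maximum is over all partitions $\mathcal A$ of $V(G)$ into non-empty parts (and $q^*(G)=0$ if $G$ has no edges). The process $(G_1^t)_{t\ge 0}$ starts with the null graph $G_1^0$. Given $G_1^{t-1}$ with vertices $v_1,\dots,v_{t-1}$, the graph $G_1^t$ is formed by adding a vertex $v_t$ and a single edge between $v_t$ and $v_i$, where $i$ is random with $\mathbb P(i=s)=\deg(v_s,t-1)/(2t-1)$ for $1\le s\le t-1$ and $\mathbb P(i=t)=1/(2t-1)$; here $\deg(v_s,t-1)$ is the degree of $v_s$ in $G_1^{t-1}$. For $m\ge 1$, the preferential attachment graph $G_m^n$ is the multigraph on $n$ vertices obtained from $G_1^{mn}$ by identifying the first $m$ vertices, the next $m$ vertices, and so on.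 An event holds a.a.s. if its probability tends to $1$ as $n\to\infty$. Theorem. Let $m\ge 1$ be a fixed integer. For every $\varepsilon>0$ there is a constant $C=C(m,\varepsilon)$ such that a.a.s. $$q^*(G_m^n)\ \ge\ \frac1m-C\,n^{-1/4+\varepsilon}.$$ Moreover, a.a.s. $q^*(G_m^n)\ge \frac1m-o(1)$, that is, there is a deterministic sequence $\delta_n\to 0$ with $q^*(G_m^n)\ge \frac1m-\delta_n$ a.a.s. Both statements hold for the multigraph $G_m^n$ itself and also for the simple graph obtained from $G_m^n$ by removing loops and replacing parallel edges by single edges (with the same constant $C$ and the same sequence $\delta_n$). -/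

import Mathlib

open Filter Topology
open scoped ENNReal

noncomputable section

namespace PrefAttach

/-! ### Modularity of finite multigraphs -/

section Modularity

variable {α β : Type*}

/-- The degree of a vertex in a (finite) multigraph: edges are counted with multiplicity and every
loop is counted twice. -/
def degree (G : Graph α β) (v : α) : ℕ :=
  (G.incidenceSet v).ncard + (G.loopSet v).ncard

/-- The volume of a set of vertices: the sum of the degrees. -/
def vol (G : Graph α β) (A : Set α) : ℕ := ∑ᶠ v ∈ A, degree G v

/-- `e(A)`: the number of edges of the graph induced by `A` (loops at `A` included). -/
def inducedEdges (G : Graph α β) (A : Set α) : ℕ := (G.induce A).edgeSet.ncard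

/-- The score of a partition of the vertex set: edge contribution minus degree tax.
(For a graph without edges every score is `0`.) -/
def score (G : Graph α β) (P : Finpartition G.vertexSet) : ℝ :=
  ∑ A ∈ P.parts,
    ((inducedEdges G A : ℝ) / (G.edgeSet.ncard : ℝ)
      - (vol G A : ℝ) ^ 2 / (4 * (G.edgeSet.ncard : ℝ) ^ 2))

/-- The modularity of a finite graph: the maximum score of a partition of the vertex set
(see `exists_modularity_eq_score` and `score_le_modularity`). -/
def modularity (G : Graph α β) : ℝ := ⨆ P : Finpartition G.vertexSet, score G P

theorem finite_finpartition [Finite α] (s : Set α) : Finite (Finpartition s) := by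
  refine Finite.of_injective (fun P : Finpartition s => P.parts) ?_
  intro P Q h
  exact Finpartition.ext h

theorem exists_modularity_eq_score [Finite α] (G : Graph α β) :
    ∃ P : Finpartition G.vertexSet, modularity G = score G P := by
  have := finite_finpartition G.vertexSet
  obtain ⟨P, hP⟩ := exists_eq_ciSup_of_finite (f := fun P : Finpartition G.vertexSet => score G P)
  exact ⟨P, hP.symm⟩

theorem score_le_modularity [Finite α] (G : Graph α β) (P : Finpartition G.vertexSet) :
    score G P ≤ modularity G := by
  have := finite_finpartition G.vertexSet
  exact le_ciSup (f := fun P : Finpartition G.vertexSet => score G P) (Set.finite_range _).bddAbove P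

/-- The simple graph obtained from a multigraph by removing the loops and by replacing
all parallel edges by a single edge, again viewed as a multigraph. -/
def simplify (G : Graph α β) : Graph G.vertexSet (Sym2 G.vertexSet) :=
  Graph.ofSimpleGraph G.toSimpleGraph

end Modularity

/-! ### The preferential attachment process -/

/-- The multigraph on `t` vertices in which every vertex `v` sends exactly one edge, namely the
edge named `v`, to the vertex `f v`. -/
def attachGraph {t : ℕ} (f : Fin t → Fin t) : Graph (Fin t) (Fin t) where
  vertexSet := Set.univ
  IsLink e x y := s(x, y) = s(e, f e)
  edgeSet := Set.univ
  isLink_symm e _ := ⟨fun x y h => by rw [Sym2.eq_swap]; exact h⟩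
  eq_or_eq_of_isLink_of_isLink e x y v w h h' := by
    have := h.trans h'.symm
    rw [Sym2.eq_iff] at this
    tauto
  edge_mem_iff_exists_isLink e := by
    simp only [Set.mem_univ, true_iff]
    exact ⟨e, f e, rfl⟩
  left_mem_of_isLink := fun _ _ _ _ => Set.mem_univ _

theorem degree_attachGraph {t : ℕ} (f : Fin t → Fin t) (s : Fin t) :
    degree (attachGraph f) s = 1 + {e | f e = s}.ncard := by
  have h1 : (attachGraph f).incidenceSet s = {s} ∪ {e | f e = s} := by
    ext e
    simp only [Graph.incidenceSet, Graph.Inc, attachGraph, Set.mem_ofPred_eq, Set.mem_union,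
      Set.mem_singleton_iff, Sym2.eq_iff]
    constructor
    · rintro ⟨y, ⟨h, -⟩ | ⟨h, -⟩⟩
      · exact Or.inl h.symm
      · exact Or.inr h.symm
    · rintro (h | h)
      · exact ⟨f e, Or.inl ⟨h.symm, rfl⟩⟩
      · exact ⟨e, Or.inr ⟨h.symm, rfl⟩⟩
  have h2 : (attachGraph f).loopSet s = {s} ∩ {e | f e = s} := by
    ext e
    simp only [Graph.loopSet, Graph.IsLoopAt, attachGraph, Set.mem_ofPred_eq, Set.mem_inter_iff,
      Set.mem_singleton_iff, Sym2.eq_iff]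
    constructor
    · rintro (⟨h, h'⟩ | ⟨h, h'⟩)
      · exact ⟨h.symm, h'.symm⟩
      · exact ⟨h'.symm, h.symm⟩
    · rintro ⟨h, h'⟩
      exact Or.inl ⟨h.symm, h'.symm⟩
  rw [degree, h1, h2, Set.ncard_union_add_ncard_inter _ _ (Set.toFinite _) (Set.toFinite _),
    Set.ncard_singleton]

theorem sum_degree_attachGraph {t : ℕ} (f : Fin t → Fin t) :
    ∑ s, degree (attachGraph f) s = 2 * t := by
  have h : ∑ s, {e | f e = s}.ncard = t := by
    have := Finset.card_eq_sum_card_fiberwise (f := f) (s := Finset.univ) (t := Finset.univ)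
      (fun _ _ => Finset.mem_coe.2 (Finset.mem_univ _))
    rw [Finset.card_univ, Fintype.card_fin] at this
    refine Eq.trans (Finset.sum_congr rfl fun s _ => ?_) this.symm
    rw [← Set.ncard_coe_finset]
    simp
  simp only [degree_attachGraph, Finset.sum_add_distrib, h]
  simp
  omega

/-- The attachment probabilities at step `t + 1`, given the graph after `t` steps: the new vertex
(the last element of `Fin (t + 1)`) sends its edge to the old vertex `s` with probability
`deg(s) / (2 (t + 1) - 1)`, and to itself with probability `1 / (2 (t + 1) - 1)`. -/
def stepProb {t : ℕ} (f : Fin t → Fin t) : Fin (t + 1) → ℝ≥0∞ :=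
  Fin.snoc (α := fun _ => ℝ≥0∞)
    (fun s => (degree (attachGraph f) s : ℝ≥0∞) / (2 * t + 1 : ℕ)) (1 / (2 * t + 1 : ℕ))

theorem sum_stepProb {t : ℕ} (f : Fin t → Fin t) : ∑ i, stepProb f i = 1 := by
  rw [Fin.sum_univ_castSucc]
  simp only [stepProb, Fin.snoc_castSucc, Fin.snoc_last, ENNReal.div_eq_inv_mul]
  rw [← Finset.mul_sum, ← mul_add, ← Nat.cast_sum, sum_degree_attachGraph, ← Nat.cast_add_one]
  exact ENNReal.inv_mul_cancel (Nat.cast_ne_zero.2 (Nat.succ_ne_zero _)) (ENNReal.natCast_ne_top _)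

/-- The law of the vertex chosen at step `t + 1`, given the graph after `t` steps. -/
def stepLaw {t : ℕ} (f : Fin t → Fin t) : PMF (Fin (t + 1)) :=
  PMF.ofFintype (stepProb f) (sum_stepProb f)

/-- Add a new vertex which sends its edge to `i`. -/
def extend {t : ℕ} (f : Fin t → Fin t) (i : Fin (t + 1)) : Fin (t + 1) → Fin (t + 1) :=
  Fin.snoc (α := fun _ => Fin (t + 1)) (fun s => (f s).castSucc) i

/-- The law of the first `t` steps of the process with one edge per vertex, recorded as the function
that maps a vertex to the vertex that it sends its edge to. The graph after `t` steps is the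
`attachGraph` of this random function. -/
def attachLaw : (t : ℕ) → PMF (Fin t → Fin t)
  | 0 => PMF.pure Fin.elim0
  | t + 1 => (attachLaw t).bind fun f => (stepLaw f).map (extend f)

/-- The law of the preferential attachment multigraph with `n` vertices and `m` edges per vertex
(for `m ≥ 1`): the first `n * m` vertices of the process with one edge per vertex are identified in
consecutive blocks of length `m` (`Fin.divNat` maps `i` to `i / m`). -/
def prefAttachGraph (m n : ℕ) : PMF (Graph (Fin n) (Fin (n * m))) :=
  (attachLaw (n * m)).map fun f =>
    (attachGraph f).map (Fin.divNat : Fin (n * m) → Fin n)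

/-- A sequence of events, the `n`-th one in the `n`-th discrete probability space, holds
asymptotically almost surely if its probability tends to `1`. -/
def AAS {Ω : ℕ → Type*} (P : ∀ n, PMF (Ω n)) (E : ∀ n, Set (Ω n)) : Prop :=
  Tendsto (fun n => (P n).toOuterMeasure (E n)) atTop (𝓝 1)

end PrefAttach

end

/-! Almost surely every edge of the process goes to an earlier vertex or to its own, so the first
edges of the `n` merged vertices form a forest, up to roots. These first edges are roughly a
fraction `1/m` of all edges; it suffices to keep almost all of them inside parts whose degree tax is
negligible.

Weight the vertices by degree and cut off, from the leaves upwards, each subtree whose remaining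
weight reaches `x` (`exists_pieces`). Every cut releases weight at least `x` out of a total `2nm`,
so at most `2nm/x` edges are cut. Below the root `r` of a piece hang fewer than `x` units per child,
and the children of `r` number at most its degree, so the piece weighs at most `(1 + x) deg r`. The
tax is thus at most `(1 + x)^2` times the sum of squared degrees, over `n^2`.

Linear recursions bound the expected sum of squared degrees by `O(n log n)` and the expected number
of loops by `O(log n)`. By Markov's inequality they are a.a.s. at most `n^(5/4)` and `n^(3/4)`. With
`x` about `n^(1/4)` the losses from loops, cuts and tax are all `O(n^(-1/4))`, without any `ε`.

Simplification keeps every non-loop forest edge distinct, does not increase degrees or the number of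
edges, and leaves at least `n/2` edges, so `le_modularity_of_firstNeighbor` covers both graphs. -/

noncomputable section

namespace PrefAttach

/-! ### Cutting a forest into pieces of small weight -/

section Forest

variable {n : ℕ}

/-- The weight hanging below `v` in the forest with parent function `p`, after the subtrees of
weight at least `x` have been cut off. -/
def hangingWeight (p : Fin n → Fin n) (w : Fin n → ℕ) (x : ℕ) (v : Fin n) : ℕ :=
  w v + ∑ c ∈ (Finset.univ.filter fun c => v < c).attach,
    if p c.1 = v ∧ hangingWeight p w x c.1 < x then hangingWeight p w x c.1 else 0
termination_by n - v
decreasing_by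
  all_goals
    have := (Finset.mem_filter.1 c.2).2
    omega

open Classical in
/-- The root of the piece of `v`, after the subtrees of weight at least `x` have been cut off. -/
def pieceRoot (p : Fin n → Fin n) (w : Fin n → ℕ) (x : ℕ) (v : Fin n) : Fin n :=
  if _h : p v < v ∧ hangingWeight p w x v < x then pieceRoot p w x (p v) else v
termination_by v
decreasing_by exact _h.1

variable {p : Fin n → Fin n} {w : Fin n → ℕ} {x : ℕ}

/-- The condition on `c` is exactly the one under which `pieceRoot` passes from `c` to its parent;
`p c < c` also discards the roots, which are their own parents. -/
theorem hangingWeight_eq (v : Fin n) :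
    hangingWeight p w x v =
      w v + ∑ c with p c = v ∧ (p c < c ∧ hangingWeight p w x c < x), hangingWeight p w x c := by
  rw [hangingWeight, Finset.sum_attach (Finset.univ.filter fun c => v < c)
    (fun c => if p c = v ∧ hangingWeight p w x c < x then hangingWeight p w x c else 0),
    ← Finset.sum_filter, Finset.filter_filter]
  congr 1
  refine Finset.sum_congr (Finset.filter_congr fun c _ => ?_) fun _ _ => rfl
  constructor
  · rintro ⟨h1, h2, h3⟩
    exact ⟨h2, h2 ▸ h1, h3⟩
  · rintro ⟨h1, h2, h3⟩
    exact ⟨h1 ▸ h2, h1, h3⟩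

theorem pieceRoot_of_uncut {v : Fin n} (h : p v < v ∧ hangingWeight p w x v < x) :
    pieceRoot p w x v = pieceRoot p w x (p v) := by
  rw [pieceRoot, dif_pos h]

theorem pieceRoot_of_cut {v : Fin n} (h : ¬(p v < v ∧ hangingWeight p w x v < x)) :
    pieceRoot p w x v = v := by
  rw [pieceRoot, dif_neg h]

theorem pieceRoot_not_uncut (v : Fin n) :
    ¬(p (pieceRoot p w x v) < pieceRoot p w x v ∧
      hangingWeight p w x (pieceRoot p w x v) < x) := by
  induction v using WellFoundedLT.induction with
  | ind v ih =>
    by_cases h : p v < v ∧ hangingWeight p w x v < x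
    · rw [pieceRoot_of_uncut h]
      exact ih _ h.1
    · rwa [pieceRoot_of_cut h]

/-- Sum the recursion for the hanging weight over the piece of `r`. Each member other than `r`
occurs exactly once as an uncut child, so its hanging weight cancels and only that of `r` survives.
-/
theorem sum_pieceRoot_eq {r : Fin n}
    (hr : ¬(p r < r ∧ hangingWeight p w x r < x)) :
    ∑ v with pieceRoot p w x v = r, w v = hangingWeight p w x r := by
  classical
  set W := hangingWeight p w x
  set T := pieceRoot p w x
  have h1 : ∑ v with T v = r, W v =
      ∑ v with T v = r, w v + ∑ v with T v = r, ∑ c with p c = v ∧ (p c < c ∧ W c < x), W c := by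
    rw [← Finset.sum_add_distrib]
    exact Finset.sum_congr rfl fun v _ => hangingWeight_eq v
  have h2 : ∑ v with T v = r, ∑ c with p c = v ∧ (p c < c ∧ W c < x), W c =
      ∑ c with T c = r ∧ (p c < c ∧ W c < x), W c := by
    have h : ∀ v, (Finset.univ.filter fun c => p c = v ∧ (p c < c ∧ W c < x)) =
        (Finset.univ.filter fun c => p c < c ∧ W c < x).filter fun c => p c = v := by
      intro v
      rw [Finset.filter_filter]
      exact Finset.filter_congr fun _ _ => and_comm
    simp_rw [h]
    rw [Finset.sum_fiberwise_eq_sum_filter, Finset.filter_filter]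
    refine Finset.sum_congr (Finset.filter_congr fun c _ => ?_) fun _ _ => rfl
    rw [and_comm, and_congr_left_iff]
    intro hc
    rw [Finset.mem_filter_univ, show T c = T (p c) from pieceRoot_of_uncut hc]
  have h3 : ∑ v with T v = r, W v =
      ∑ c with T c = r ∧ (p c < c ∧ W c < x), W c + W r := by
    rw [← Finset.sum_filter_add_sum_filter_not (Finset.univ.filter fun v => T v = r)
      (fun c => p c < c ∧ W c < x), Finset.filter_filter, Finset.filter_filter]
    congr 1
    rw [Finset.sum_eq_single_of_mem r]
    · exact Finset.mem_filter.2 ⟨Finset.mem_univ _, pieceRoot_of_cut hr, hr⟩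
    · intro v hv hvr
      obtain ⟨-, hv1, hv2⟩ := Finset.mem_filter.1 hv
      exact absurd ((pieceRoot_of_cut hv2).symm.trans hv1) hvr
  omega

/-- A weighted forest can be cut into pieces, labelled by their roots, such that few edges are cut
and such that the weight of a piece is controlled by the weight and the number of children of its
root. -/
theorem exists_pieces (p : Fin n → Fin n) (hp : ∀ v, p v ≤ v) (w : Fin n → ℕ) (x : ℕ) :
    ∃ T : Fin n → Fin n,
      x * (Finset.univ.filter fun v => p v ≠ v ∧ T v ≠ T (p v)).card ≤ ∑ v, w v ∧
      ∀ r, ∑ v with T v = r, w v ≤ w r + x * (Finset.univ.filter fun c => p c = r ∧ c ≠ r).card := by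
  classical
  refine ⟨pieceRoot p w x, ?_, fun r => ?_⟩
  · calc x * (Finset.univ.filter fun v =>
          p v ≠ v ∧ pieceRoot p w x v ≠ pieceRoot p w x (p v)).card
        = ∑ v with p v ≠ v ∧ pieceRoot p w x v ≠ pieceRoot p w x (p v), x := by
          rw [Finset.sum_const, smul_eq_mul, mul_comm]
      _ ≤ ∑ v with p v ≠ v ∧ pieceRoot p w x v ≠ pieceRoot p w x (p v),
            ∑ u with pieceRoot p w x u = v, w u := by
          -- A cut edge leaves from a non-root `v`, so the cut can only be due to hanging weight at
          -- least `x`, which is the weight of the piece rooted at `v`.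
          refine Finset.sum_le_sum fun v hv => ?_
          obtain ⟨-, h1, h2⟩ := Finset.mem_filter.1 hv
          have h3 : ¬(p v < v ∧ hangingWeight p w x v < x) :=
            fun h => h2 (pieceRoot_of_uncut h)
          rw [sum_pieceRoot_eq h3]
          by_contra h4
          exact h3 ⟨lt_of_le_of_ne (hp v) h1, not_le.1 h4⟩
      _ ≤ ∑ v, ∑ u with pieceRoot p w x u = v, w u :=
          Finset.sum_le_sum_of_subset (Finset.filter_subset _ _)
      _ = ∑ v, w v := Finset.sum_fiberwise _ _ _
  · by_cases hr : p r < r ∧ hangingWeight p w x r < x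
    -- An uncut vertex is never a piece root, so its fibre is empty.
    · rw [Finset.filter_false_of_mem]
      · simp
      · rintro v - rfl
        exact pieceRoot_not_uncut v hr
    · rw [sum_pieceRoot_eq hr, hangingWeight_eq]
      gcongr
      calc ∑ c with p c = r ∧ (p c < c ∧ hangingWeight p w x c < x), hangingWeight p w x c
          ≤ ∑ c with p c = r ∧ (p c < c ∧ hangingWeight p w x c < x), x :=
            Finset.sum_le_sum fun c hc => (Finset.mem_filter.1 hc).2.2.2.le
        _ = x * (Finset.univ.filter fun c =>
              p c = r ∧ (p c < c ∧ hangingWeight p w x c < x)).card := by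
            rw [Finset.sum_const, smul_eq_mul, mul_comm]
        _ ≤ _ := by
            refine Nat.mul_le_mul_left x (Finset.card_le_card ?_)
            refine Finset.monotone_filter_right _ fun c _ h => ⟨h.1, ?_⟩
            rw [← h.1]
            exact h.2.1.ne'

end Forest

/-! ### Lower bounds for the modularity -/

section ModularityBound

variable {α β ι : Type*}

theorem inducedEdges_empty (G : Graph α β) : inducedEdges G ∅ = 0 := by
  simp [inducedEdges, Graph.edgeSet_induce]

theorem vol_empty (G : Graph α β) : vol G ∅ = 0 := by
  simp [vol]

/-- The partition of the vertices into the fibres of a labelling. -/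
theorem sum_fibers_le_modularity [Finite α] [Fintype ι] (G : Graph α β)
    (hV : G.vertexSet = Set.univ) (L : α → ι) :
    ∑ r, ((inducedEdges G (L ⁻¹' {r}) : ℝ) / (G.edgeSet.ncard : ℝ)
      - (vol G (L ⁻¹' {r}) : ℝ) ^ 2 / (4 * (G.edgeSet.ncard : ℝ) ^ 2)) ≤ modularity G := by
  classical
  have hdisj : Pairwise (Function.onFun Disjoint fun r => L ⁻¹' {r}) := fun r s hrs =>
    Disjoint.preimage L (Set.disjoint_singleton.2 hrs)
  let parts : Finset (Set α) := Finset.univ.image fun r => L ⁻¹' {r}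
  have hind : parts.SupIndep id := by
    rw [Finset.supIndep_iff_pairwiseDisjoint]
    intro A hA B hB hAB
    simp only [parts, Finset.coe_image, Finset.coe_univ, Set.image_univ, Set.mem_range] at hA hB
    obtain ⟨r, rfl⟩ := hA
    obtain ⟨s, rfl⟩ := hB
    exact hdisj fun h => hAB (by rw [h])
  have hsup : parts.sup id = G.vertexSet := by
    rw [hV]
    refine Set.eq_univ_of_forall fun v => ?_
    have : L ⁻¹' {L v} ≤ parts.sup id :=
      Finset.le_sup (f := id) (Finset.mem_image_of_mem _ (Finset.mem_univ (L v)))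
    exact this rfl
  -- Labels may be unused. Their fibres all coincide with the empty set, which is not allowed as a
  -- part but contributes zero to the sum.
  refine le_trans (le_of_eq ?_) (score_le_modularity G (Finpartition.ofErase parts hind hsup))
  rw [score, Finpartition.ofErase_parts, Finset.sum_erase]
  · rw [Finset.sum_image_of_disjoint]
    · simp [inducedEdges_empty, vol_empty]
    · exact hdisj.set_pairwise _
  · simp [inducedEdges_empty, vol_empty]

theorem card_le_ncard_of_injOn {γ : Type*} [Finite β] (s : Finset γ) (t : Set β) (f : γ → β)
    (hf : ∀ a ∈ s, f a ∈ t) (hinj : Set.InjOn f s) : s.card ≤ t.ncard := by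
  rw [← Set.ncard_coe_finset, ← hinj.ncard_image]
  refine Set.ncard_le_ncard ?_ (Set.toFinite _)
  rintro _ ⟨a, ha, rfl⟩
  exact hf a ha

/-- If a multigraph contains a forest of edges `ε v` joining `v` to `p v`, and if a labelling of
the vertices has fibres of small weight and cuts few of these edges, then the modularity is
large. -/
theorem le_modularity_of_forest [Finite β] {n : ℕ} (G : Graph α β) (hV : G.vertexSet = Set.univ)
    (φ : Fin n ≃ α) (p : Fin n → Fin n) (ε : Fin n → β)
    (hε : ∀ v, p v ≠ v → G.IsLink (ε v) (φ v) (φ (p v)))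
    (hinj : Set.InjOn ε {v | p v ≠ v}) (w : Fin n → ℕ) (hw : ∀ v, degree G (φ v) ≤ w v)
    (T : Fin n → Fin n) :
    ((Finset.univ.filter fun v => p v ≠ v ∧ T v = T (p v)).card : ℝ) / (G.edgeSet.ncard : ℝ)
      - (∑ r, ((∑ v with T v = r, w v : ℕ) : ℝ) ^ 2) / (4 * (G.edgeSet.ncard : ℝ) ^ 2)
      ≤ modularity G := by
  classical
  have : Finite α := Finite.of_equiv _ φ
  refine le_trans ?_ (sum_fibers_le_modularity G hV (T ∘ φ.symm))
  rw [Finset.sum_sub_distrib, ← Finset.sum_div, ← Finset.sum_div, ← Nat.cast_sum]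
  have hedges : (Finset.univ.filter fun v => p v ≠ v ∧ T v = T (p v)).card ≤
      ∑ r, inducedEdges G (T ∘ φ.symm ⁻¹' {r}) := by
    rw [Finset.card_eq_sum_card_fiberwise (f := T) (t := Finset.univ)
      fun _ _ => Finset.mem_coe.2 (Finset.mem_univ _)]
    refine Finset.sum_le_sum fun r _ => ?_
    refine card_le_ncard_of_injOn _ _ ε (fun v hv => ?_) fun u hu v hv huv => ?_
    · simp only [Finset.mem_filter, Finset.mem_univ, true_and] at hv
      obtain ⟨⟨h1, h2⟩, h3⟩ := hv
      rw [Graph.edgeSet_induce]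
      exact ⟨_, _, hε v h1, by simpa using h3, by simpa [← h2] using h3⟩
    · simp only [Finset.coe_filter, Finset.mem_filter, Finset.mem_univ, true_and,
        Set.mem_ofPred_eq] at hu hv
      exact hinj hu.1.1 hv.1.1 huv
  have hvol : ∀ r, vol G (T ∘ φ.symm ⁻¹' {r}) ≤ ∑ v with T v = r, w v := by
    intro r
    have : T ∘ φ.symm ⁻¹' {r} =
        ((Finset.univ.filter fun v => T v = r).map φ.toEmbedding : Finset α) := by
      ext a
      simp
    rw [vol, this, finsum_mem_coe_finset, Finset.sum_map]
    exact Finset.sum_le_sum fun v _ => hw v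
  gcongr
  exact hvol _

end ModularityBound

/-! ### Simplification -/

section Simplify

variable {α β : Type*} (G : Graph α β)

theorem vertexSet_simplify : (simplify G).vertexSet = Set.univ := rfl

theorem isLink_simplify {e : β} {u v : G.vertexSet} (h : G.IsLink e u v) (huv : u ≠ v) :
    (simplify G).IsLink s(u, v) u v := by
  refine ⟨rfl, ?_⟩
  rw [SimpleGraph.mem_edgeSet]
  exact ⟨huv, e, h⟩

/-- Choose an original edge over each simple edge; the choice is injective because an edge
determines its unordered pair of ends. -/
theorem ncard_edgeSet_simplify_le [Finite β] :
    (simplify G).edgeSet.ncard ≤ G.edgeSet.ncard := by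
  classical
  have h : ∀ s ∈ (simplify G).edgeSet, ∃ e, ∃ u v : G.vertexSet, s = s(u, v) ∧ G.IsLink e u v := by
    intro s hs
    obtain ⟨u, v, rfl, hs⟩ := (simplify G).edge_mem_iff_exists_isLink s |>.1 hs
    rw [SimpleGraph.mem_edgeSet] at hs
    obtain ⟨-, e, he⟩ := hs
    exact ⟨e, u, v, rfl, he⟩
  choose g u v hs hg using h
  rw [← Nat.card_coe_set_eq, ← Nat.card_coe_set_eq]
  refine Nat.card_le_card_of_injective (fun s => ⟨g s.1 s.2, (hg s.1 s.2).edge_mem⟩) ?_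
  rintro ⟨s, hs1⟩ ⟨t, ht1⟩ hst
  replace hst : g s hs1 = g t ht1 := congrArg Subtype.val hst
  refine Subtype.ext (show s = t from ?_)
  have h1 := hg s hs1
  have h2 := hg t ht1
  rw [← hst] at h2
  rw [hs s hs1, hs t ht1]
  rcases h1.eq_and_eq_or_eq_and_eq h2 with ⟨h3, h4⟩ | ⟨h3, h4⟩
  · rw [Subtype.ext h3, Subtype.ext h4]
  · rw [Subtype.ext h3, Subtype.ext h4, Sym2.eq_swap]

theorem degree_simplify_le [Finite β] (v : G.vertexSet) :
    degree (simplify G) v ≤ degree G v := by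
  have hloop : (simplify G).loopSet v = ∅ := by
    refine Set.eq_empty_of_forall_notMem fun s hs => ?_
    obtain ⟨rfl, hs⟩ := hs
    rw [SimpleGraph.mem_edgeSet] at hs
    exact hs.1 rfl
  rw [degree, hloop, Set.ncard_empty, add_zero]
  refine le_trans ?_ (Nat.le_add_right _ _)
  have h : ∀ s ∈ (simplify G).incidenceSet v, ∃ e, ∃ u : G.vertexSet,
      s = s(v, u) ∧ v ≠ u ∧ G.IsLink e v u := by
    rintro s ⟨u, rfl, hs⟩
    rw [SimpleGraph.mem_edgeSet] at hs
    obtain ⟨hne, e, he⟩ := hs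
    exact ⟨e, u, rfl, hne, he⟩
  choose g u hs hne hg using h
  rw [← Nat.card_coe_set_eq, ← Nat.card_coe_set_eq]
  refine Nat.card_le_card_of_injective (fun s => ⟨g s.1 s.2, _, hg s.1 s.2⟩) ?_
  rintro ⟨s, hs1⟩ ⟨t, ht1⟩ hst
  replace hst : g s hs1 = g t ht1 := congrArg Subtype.val hst
  refine Subtype.ext (show s = t from ?_)
  have h1 := hg s hs1
  have h2 := hg t ht1
  rw [← hst] at h2
  rw [hs s hs1, hs t ht1]
  rcases h1.eq_and_eq_or_eq_and_eq h2 with ⟨-, h4⟩ | ⟨h3, h4⟩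
  · rw [Subtype.ext h4]
  · exact absurd (Subtype.ext h3) (hne t ht1)

end Simplify

/-! ### The forest of the first edges in the graph with identified vertices -/

section Blocks

variable {m n : ℕ}

/-- The first edge sent out by the vertex `v` of the graph with `m` edges per vertex. -/
def firstEdge (hm : 1 ≤ m) (v : Fin n) : Fin (n * m) := finProdFinEquiv (v, ⟨0, hm⟩)

/-- The vertex that the first edge of `v` is sent to. -/
def firstNeighbor (hm : 1 ≤ m) (f : Fin (n * m) → Fin (n * m)) (v : Fin n) : Fin n :=
  (f (firstEdge hm v)).divNat

/-- The total degree of a block of `m` consecutive vertices. -/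
def blockDegree (f : Fin (n * m) → Fin (n * m)) (v : Fin n) : ℕ :=
  ∑ j with Fin.divNat j = v, degree (attachGraph f) j

theorem divNat_firstEdge (hm : 1 ≤ m) (v : Fin n) : (firstEdge hm v).divNat = v :=
  congrArg Prod.fst (finProdFinEquiv.symm_apply_apply (v, (⟨0, hm⟩ : Fin m)))

theorem firstEdge_injective (hm : 1 ≤ m) : Function.Injective (firstEdge (n := n) hm) :=
  Function.LeftInverse.injective (divNat_firstEdge hm)

theorem val_firstEdge (hm : 1 ≤ m) (v : Fin n) : (firstEdge hm v : ℕ) = m * v := by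
  simp [firstEdge]

variable {f : Fin (n * m) → Fin (n * m)}

theorem firstNeighbor_le (hm : 1 ≤ m) (hf : ∀ e, f e ≤ e) (v : Fin n) :
    firstNeighbor hm f v ≤ v := by
  conv_rhs => rw [← divNat_firstEdge hm v]
  exact Nat.div_le_div_right (hf _)

theorem card_block (v : Fin n) :
    (Finset.univ.filter fun j : Fin (n * m) => Fin.divNat j = v).card = m := by
  have : (Finset.univ.filter fun j : Fin (n * m) => Fin.divNat j = v) =
      Finset.univ.map ⟨fun i : Fin m => finProdFinEquiv (v, i), fun i j h => by simpa using h⟩ := by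
    ext j
    simp only [Finset.mem_filter, Finset.mem_univ, true_and, Finset.mem_map]
    constructor
    · rintro rfl
      exact ⟨j.modNat, finProdFinEquiv.apply_symm_apply j⟩
    · rintro ⟨i, rfl⟩
      exact congrArg Prod.fst (finProdFinEquiv.symm_apply_apply (v, i))
  rw [this, Finset.card_map, Finset.card_univ, Fintype.card_fin]

theorem blockDegree_eq (f : Fin (n * m) → Fin (n * m)) (v : Fin n) :
    blockDegree f v = {e : Fin (n * m) | Fin.divNat e = v}.ncard + {e | (f e).divNat = v}.ncard := by
  classical
  rw [blockDegree]
  simp only [degree_attachGraph, Finset.sum_add_distrib]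
  congr 1
  · rw [Finset.sum_const, smul_eq_mul, mul_one, ← Set.ncard_coe_finset]
    simp
  · rw [← Finset.coe_filter_univ, Set.ncard_coe_finset,
      Finset.card_eq_sum_card_fiberwise (f := f) (t := Finset.univ.filter fun j => Fin.divNat j = v)]
    · refine Finset.sum_congr rfl fun j hj => ?_
      rw [← Set.ncard_coe_finset]
      congr 1
      ext e
      simp only [Finset.mem_filter, Finset.mem_univ, true_and] at hj
      simp only [Set.mem_ofPred_eq, Finset.coe_filter, Finset.mem_filter, Finset.mem_univ, true_and]
      exact ⟨fun h => ⟨h ▸ hj, h⟩, fun h => h.2⟩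
    · intro e he
      simpa using he

/-- Merging can create new loops, but the edges at `v` are still the union, and the loops the
intersection, of the edges leaving the block and the edges entering it. -/
theorem degree_map_attachGraph (f : Fin (n * m) → Fin (n * m)) (v : Fin n) :
    degree ((attachGraph f).map Fin.divNat) v = blockDegree f v := by
  have key : ∀ e x y, ((attachGraph f).map Fin.divNat).IsLink e x y ↔
      s(x, y) = s(Fin.divNat e, (f e).divNat) := by
    intro e x y
    constructor
    · rintro ⟨u, v, h, rfl, rfl⟩
      exact congrArg (Sym2.map Fin.divNat) (h : s(u, v) = s(e, f e))
    · intro h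
      rcases Sym2.eq_iff.1 h with ⟨rfl, rfl⟩ | ⟨rfl, rfl⟩
      · exact ⟨_, _, rfl, rfl, rfl⟩
      · exact ⟨_, _, Sym2.eq_swap, rfl, rfl⟩
  have h1 : ((attachGraph f).map Fin.divNat).incidenceSet v =
      {e : Fin (n * m) | Fin.divNat e = v} ∪ {e | (f e).divNat = v} := by
    ext e
    simp only [Graph.incidenceSet, Graph.Inc, key, Set.mem_ofPred_eq, Set.mem_union, Sym2.eq_iff]
    constructor
    · rintro ⟨y, ⟨h, -⟩ | ⟨h, -⟩⟩
      · exact Or.inl h.symm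
      · exact Or.inr h.symm
    · rintro (h | h)
      · exact ⟨_, Or.inl ⟨h.symm, rfl⟩⟩
      · exact ⟨_, Or.inr ⟨h.symm, rfl⟩⟩
  have h2 : ((attachGraph f).map Fin.divNat).loopSet v =
      {e : Fin (n * m) | Fin.divNat e = v} ∩ {e | (f e).divNat = v} := by
    ext e
    simp only [Graph.loopSet, Graph.IsLoopAt, key, Set.mem_ofPred_eq, Set.mem_inter_iff,
      Sym2.eq_iff]
    constructor
    · rintro (⟨h, h'⟩ | ⟨h, h'⟩)
      · exact ⟨h.symm, h'.symm⟩
      · exact ⟨h'.symm, h.symm⟩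
    · rintro ⟨h, h'⟩
      exact Or.inl ⟨h.symm, h'.symm⟩
  rw [degree, h1, h2, Set.ncard_union_add_ncard_inter _ _ (Set.toFinite _) (Set.toFinite _),
    blockDegree_eq]

theorem sum_blockDegree (f : Fin (n * m) → Fin (n * m)) :
    ∑ v, blockDegree f v = 2 * (n * m) := by
  rw [← sum_degree_attachGraph f]
  exact Finset.sum_fiberwise _ _ _

/-- Cauchy–Schwarz inside each block of `m` vertices; this reduces second moments to the process
with one edge per vertex. -/
theorem sum_sq_blockDegree_le (f : Fin (n * m) → Fin (n * m)) :
    ∑ v, blockDegree f v ^ 2 ≤ m * ∑ j, degree (attachGraph f) j ^ 2 := by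
  rw [← Finset.sum_fiberwise Finset.univ Fin.divNat fun j => degree (attachGraph f) j ^ 2,
    Finset.mul_sum]
  refine Finset.sum_le_sum fun v _ => ?_
  refine (sq_sum_le_card_mul_sum_sq).trans ?_
  rw [card_block, Nat.cast_id]

theorem card_children_le (hm : 1 ≤ m) (f : Fin (n * m) → Fin (n * m)) (r : Fin n) :
    (Finset.univ.filter fun c => firstNeighbor hm f c = r ∧ c ≠ r).card ≤ blockDegree f r := by
  rw [blockDegree_eq]
  refine (card_le_ncard_of_injOn _ _ (firstEdge hm) (fun c hc => ?_)
    (firstEdge_injective hm).injOn).trans (Nat.le_add_left _ _)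
  exact (Finset.mem_filter.1 hc).2.1

/-- The first edge of a block starts at its smallest vertex. As it cannot go forward, staying in the
block forces a loop already in the unmerged graph. -/
theorem card_roots_le (hm : 1 ≤ m) (hf : ∀ e, f e ≤ e) :
    (Finset.univ.filter fun v => firstNeighbor hm f v = v).card ≤ {e | f e = e}.ncard := by
  refine card_le_ncard_of_injOn _ _ (firstEdge hm) (fun v hv => ?_) (firstEdge_injective hm).injOn
  have h : (f (firstEdge hm v)).divNat = v := (Finset.mem_filter.1 hv).2
  refine le_antisymm (hf _) ?_
  rw [Fin.le_def, val_firstEdge, mul_comm, ← Nat.le_div_iff_mul_le hm]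
  exact (congrArg Fin.val h).ge

theorem vertexSet_map_attachGraph (hm : 1 ≤ m) (f : Fin (n * m) → Fin (n * m)) :
    ((attachGraph f).map Fin.divNat).vertexSet = Set.univ := by
  refine Set.eq_univ_of_forall fun v => ⟨firstEdge hm v, Set.mem_univ _, divNat_firstEdge hm v⟩

theorem ncard_edgeSet_map_attachGraph (f : Fin (n * m) → Fin (n * m)) :
    ((attachGraph f).map Fin.divNat).edgeSet.ncard = n * m := by
  have : ((attachGraph f).map Fin.divNat).edgeSet = (Set.univ : Set (Fin (n * m))) := rfl
  rw [this, Set.ncard_univ, Nat.card_fin]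

theorem isLink_firstEdge (hm : 1 ≤ m) (f : Fin (n * m) → Fin (n * m)) (v : Fin n) :
    ((attachGraph f).map Fin.divNat).IsLink (firstEdge hm v) v (firstNeighbor hm f v) :=
  ⟨_, _, rfl, divNat_firstEdge hm v, rfl⟩

/-- A lower bound for the modularity of a graph that contains the forest of the first edges and
whose degrees are bounded by the block degrees. -/
theorem le_modularity_of_firstNeighbor {α β : Type*} [Finite β] (hm : 1 ≤ m)
    (hf : ∀ e, f e ≤ e) (hn : 0 < n) (hloops : 2 * {e | f e = e}.ncard ≤ n)
    (G : Graph α β) (hV : G.vertexSet = Set.univ) (φ : Fin n ≃ α) (ε : Fin n → β)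
    (hε : ∀ v, firstNeighbor hm f v ≠ v → G.IsLink (ε v) (φ v) (φ (firstNeighbor hm f v)))
    (hinj : Set.InjOn ε {v | firstNeighbor hm f v ≠ v})
    (hdeg : ∀ v, degree G (φ v) ≤ blockDegree f v) (hE : G.edgeSet.ncard ≤ n * m)
    {x : ℕ} (hx : 0 < x) :
    1 / (m : ℝ) - {e | f e = e}.ncard / (n * m : ℝ) - 2 / x
      - (1 + x : ℝ) ^ 2 * (m * ∑ j, (degree (attachGraph f) j : ℝ) ^ 2) / (n : ℝ) ^ 2
      ≤ modularity G := by
  classical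
  set p := firstNeighbor hm f
  set w := blockDegree f
  set L := {e | f e = e}.ncard
  obtain ⟨T, hcut, hpiece⟩ := exists_pieces p (firstNeighbor_le hm hf) w x
  rw [sum_blockDegree] at hcut
  refine le_trans ?_ (le_modularity_of_forest G hV φ p ε hε hinj w hdeg T)
  set E := G.edgeSet.ncard
  set cuts := (Finset.univ.filter fun v => p v ≠ v ∧ T v ≠ T (p v)).card
  set good := (Finset.univ.filter fun v => p v ≠ v ∧ T v = T (p v)).card
  have hroots : (Finset.univ.filter fun v => p v = v).card ≤ L := card_roots_le hm hf
  have hsplit : (Finset.univ.filter fun v => p v = v).card +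
      (Finset.univ.filter fun v => p v ≠ v).card = n := by
    simpa using Finset.card_filter_add_card_filter_not (s := Finset.univ) (fun v => p v = v)
  have hsplit' : good + cuts = (Finset.univ.filter fun v => p v ≠ v).card := by
    have := Finset.card_filter_add_card_filter_not
      (s := Finset.univ.filter fun v => p v ≠ v) (fun v => T v = T (p v))
    rwa [Finset.filter_filter, Finset.filter_filter] at this
  have hEn : (Finset.univ.filter fun v => p v ≠ v).card ≤ E :=
    card_le_ncard_of_injOn _ _ ε (fun v hv => (hε v (Finset.mem_filter.1 hv).2).edge_mem)
      (by simpa using hinj)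
  -- At least `n - L` forest edges are present and `2L ≤ n`. This lower bound on `E` turns the tax
  -- denominator `4E^2` into `n^2`.
  have hE2 : n ≤ 2 * E := by omega
  have hgood : n ≤ good + cuts + L := by omega
  have hm' : (0 : ℝ) < m := by exact_mod_cast hm
  have hn' : (0 : ℝ) < n := by exact_mod_cast hn
  have hx' : (0 : ℝ) < x := by exact_mod_cast hx
  have hE0 : (0 : ℝ) < E := by
    have : 0 < E := by omega
    exact_mod_cast this
  have hE' : (E : ℝ) ≤ n * m := by exact_mod_cast hE
  have hE2' : (n : ℝ) ≤ 2 * E := by exact_mod_cast hE2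
  have hgood' : (n : ℝ) ≤ good + cuts + L := by exact_mod_cast hgood
  have hcut' : (x : ℝ) * cuts ≤ 2 * (n * m) := by exact_mod_cast hcut
  have hedge : 1 / (m : ℝ) - L / (n * m : ℝ) - 2 / x ≤ good / E := by
    have h1 : (good : ℝ) / (n * m) ≤ good / E := by gcongr
    refine le_trans ?_ h1
    have h2 : (cuts : ℝ) / (n * m) ≤ 2 / x := by
      rw [div_le_div_iff₀ (by positivity) hx']
      linarith
    have h3 : 1 / (m : ℝ) ≤ (good + cuts + L) / (n * m) := by
      rw [div_le_div_iff₀ hm' (by positivity)]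
      nlinarith
    rw [add_div, add_div] at h3
    linarith
  have htax : (∑ r, ((∑ v with T v = r, w v : ℕ) : ℝ) ^ 2) ≤
      (1 + x : ℝ) ^ 2 * (m * ∑ j, (degree (attachGraph f) j : ℝ) ^ 2) := by
    have h1 : ∀ r, ∑ v with T v = r, w v ≤ (1 + x) * w r := by
      intro r
      calc ∑ v with T v = r, w v ≤ w r + x * _ := hpiece r
        _ ≤ w r + x * w r := by
          gcongr
          exact card_children_le hm f r
        _ = (1 + x) * w r := by ring
    have h2 : ∑ r, (∑ v with T v = r, w v) ^ 2 ≤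
        (1 + x) ^ 2 * (m * ∑ j, degree (attachGraph f) j ^ 2) := by
      calc ∑ r, (∑ v with T v = r, w v) ^ 2 ≤ ∑ r, ((1 + x) * w r) ^ 2 := by
            gcongr with r
            exact h1 r
        _ = (1 + x) ^ 2 * ∑ r, w r ^ 2 := by
            rw [Finset.mul_sum]
            exact Finset.sum_congr rfl fun r _ => mul_pow _ _ _
        _ ≤ _ := by
            gcongr
            exact sum_sq_blockDegree_le f
    exact_mod_cast h2
  refine sub_le_sub hedge ?_
  gcongr
  nlinarith

theorem le_modularity_map_attachGraph (hm : 1 ≤ m) (hf : ∀ e, f e ≤ e) (hn : 0 < n)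
    (hloops : 2 * {e | f e = e}.ncard ≤ n) {x : ℕ} (hx : 0 < x) :
    1 / (m : ℝ) - {e | f e = e}.ncard / (n * m : ℝ) - 2 / x
      - (1 + x : ℝ) ^ 2 * (m * ∑ j, (degree (attachGraph f) j : ℝ) ^ 2) / (n : ℝ) ^ 2
      ≤ modularity ((attachGraph f).map (Fin.divNat : Fin (n * m) → Fin n)) :=
  le_modularity_of_firstNeighbor hm hf hn hloops _ (vertexSet_map_attachGraph hm f)
    (Equiv.refl _) (firstEdge hm) (fun v _ => isLink_firstEdge hm f v)
    (firstEdge_injective hm).injOn (fun v => (degree_map_attachGraph f v).le)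
    (ncard_edgeSet_map_attachGraph f).le hx

theorem le_modularity_simplify_map_attachGraph (hm : 1 ≤ m) (hf : ∀ e, f e ≤ e) (hn : 0 < n)
    (hloops : 2 * {e | f e = e}.ncard ≤ n) {x : ℕ} (hx : 0 < x) :
    1 / (m : ℝ) - {e | f e = e}.ncard / (n * m : ℝ) - 2 / x
      - (1 + x : ℝ) ^ 2 * (m * ∑ j, (degree (attachGraph f) j : ℝ) ^ 2) / (n : ℝ) ^ 2
      ≤ modularity (simplify ((attachGraph f).map (Fin.divNat : Fin (n * m) → Fin n))) := by
  set G := (attachGraph f).map (Fin.divNat : Fin (n * m) → Fin n) with hG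
  have hV : G.vertexSet = Set.univ := vertexSet_map_attachGraph hm f
  let φ : Fin n ≃ G.vertexSet := (Equiv.Set.univ _).symm.trans (Equiv.setCongr hV.symm)
  have hφ : ∀ v, (φ v : Fin n) = v := fun v => rfl
  refine le_modularity_of_firstNeighbor hm hf hn hloops (simplify G) (vertexSet_simplify G) φ
    (fun v => s(φ v, φ (firstNeighbor hm f v))) (fun v hv => ?_) ?_ (fun v => ?_) ?_ hx
  · exact isLink_simplify G (isLink_firstEdge hm f v) fun h => hv (φ.injective h).symm
  -- If two vertices gave the same pair without being equal, each would be the parent of the other,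
  -- which is impossible when parents never come later.
  · intro u hu v hv huv
    rcases Sym2.eq_iff.1 huv with ⟨h, -⟩ | ⟨h1, h2⟩
    · exact φ.injective h
    · have h1' := φ.injective h1
      have h2' := φ.injective h2
      have h3 := firstNeighbor_le hm hf u
      have h4 := firstNeighbor_le hm hf v
      exact le_antisymm (h1' ▸ h4) (h2' ▸ h3)
  · exact (degree_simplify_le G (φ v)).trans (degree_map_attachGraph f v).le
  · exact (ncard_edgeSet_simplify_le G).trans (ncard_edgeSet_map_attachGraph f).le

end Blocks

/-! ### Moments of the degrees and the number of loops -/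

section Moments

/-- The expectation of a function of the first `t` steps of the process. -/
def attachExpectation (t : ℕ) (φ : (Fin t → Fin t) → ℝ) : ℝ :=
  ∑ f, (attachLaw t f).toReal * φ f

theorem attachExpectation_const (t : ℕ) (c : ℝ) : attachExpectation t (fun _ => c) = c := by
  have h := (attachLaw t).tsum_coe
  rw [tsum_fintype] at h
  rw [attachExpectation, ← Finset.sum_mul,
    ← ENNReal.toReal_sum fun f _ => (attachLaw t).apply_ne_top f, h, ENNReal.toReal_one, one_mul]

theorem attachExpectation_mul_add (t : ℕ) (a b : ℝ) (φ : (Fin t → Fin t) → ℝ) :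
    attachExpectation t (fun f => a * φ f + b) = a * attachExpectation t φ + b := by
  simp only [attachExpectation, mul_add, Finset.sum_add_distrib, Finset.mul_sum, mul_left_comm a]
  congr 1
  exact attachExpectation_const t b

theorem stepLaw_toReal_castSucc {t : ℕ} (f : Fin t → Fin t) (s : Fin t) :
    (stepLaw f s.castSucc).toReal = degree (attachGraph f) s / (2 * t + 1) := by
  simp [stepLaw, stepProb, ENNReal.toReal_div]
  norm_cast

theorem stepLaw_toReal_last {t : ℕ} (f : Fin t → Fin t) :
    (stepLaw f (Fin.last t)).toReal = 1 / (2 * t + 1) := by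
  simp [stepLaw, stepProb]
  norm_cast

theorem attachExpectation_succ (t : ℕ) (φ : (Fin (t + 1) → Fin (t + 1)) → ℝ) :
    attachExpectation (t + 1) φ = attachExpectation t fun f =>
      ∑ s : Fin t, degree (attachGraph f) s / (2 * t + 1) * φ (extend f s.castSucc) +
        1 / (2 * t + 1) * φ (extend f (Fin.last t)) := by
  classical
  have key : ∀ g, (attachLaw (t + 1) g).toReal =
      ∑ f, ∑ i, (attachLaw t f).toReal * if g = extend f i then (stepLaw f i).toReal else 0 := by
    intro g
    rw [attachLaw, PMF.bind_apply, tsum_fintype, ENNReal.toReal_sum]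
    · refine Finset.sum_congr rfl fun f _ => ?_
      rw [ENNReal.toReal_mul, PMF.map_apply, tsum_fintype, ENNReal.toReal_sum, Finset.mul_sum]
      · refine Finset.sum_congr rfl fun i _ => ?_
        split_ifs <;> simp
      · intro i _
        split_ifs
        · exact PMF.apply_ne_top _ _
        · exact ENNReal.zero_ne_top
    · intro f _
      exact ENNReal.mul_ne_top (PMF.apply_ne_top _ _) (PMF.apply_ne_top _ _)
  simp only [attachExpectation, key, Finset.sum_mul]
  rw [Finset.sum_comm]
  refine Finset.sum_congr rfl fun f _ => ?_
  rw [Finset.sum_comm, ← stepLaw_toReal_last f]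
  simp only [← stepLaw_toReal_castSucc]
  rw [← Fin.sum_univ_castSucc fun i => (stepLaw f i).toReal * φ (extend f i), Finset.mul_sum]
  refine Finset.sum_congr rfl fun i _ => ?_
  rw [Finset.sum_eq_single_of_mem (extend f i) (Finset.mem_univ _)]
  · rw [if_pos rfl, mul_assoc]
  · intro g _ hg
    rw [if_neg hg, mul_zero, zero_mul]

theorem degree_attachGraph_eq_sum {t : ℕ} (f : Fin t → Fin t) (s : Fin t) :
    degree (attachGraph f) s = 1 + ∑ e, if f e = s then 1 else 0 := by
  rw [degree_attachGraph, ← Finset.card_filter, ← Set.ncard_coe_finset]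
  simp

theorem degree_extend_castSucc {t : ℕ} (f : Fin t → Fin t) (i : Fin (t + 1)) (s : Fin t) :
    degree (attachGraph (extend f i)) s.castSucc =
      degree (attachGraph f) s + if i = s.castSucc then 1 else 0 := by
  rw [degree_attachGraph_eq_sum, degree_attachGraph_eq_sum, Fin.sum_univ_castSucc]
  simp [extend, add_assoc]

theorem degree_extend_last {t : ℕ} (f : Fin t → Fin t) (i : Fin (t + 1)) :
    degree (attachGraph (extend f i)) (Fin.last t) = 1 + if i = Fin.last t then 1 else 0 := by
  rw [degree_attachGraph_eq_sum, Fin.sum_univ_castSucc]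
  simp [extend, (Fin.castSucc_lt_last _).ne]

/-- The sum of the squares of the degrees. -/
def sumSqDegree {t : ℕ} (f : Fin t → Fin t) : ℝ := ∑ s, (degree (attachGraph f) s : ℝ) ^ 2

theorem sumSqDegree_nonneg {t : ℕ} (f : Fin t → Fin t) : 0 ≤ sumSqDegree f :=
  Finset.sum_nonneg fun _ _ => sq_nonneg _

/-- Of the final `2`, one unit comes from expanding `(d + 1)^2` and one from the new vertex of
degree `1`. -/
theorem sumSqDegree_extend_castSucc {t : ℕ} (f : Fin t → Fin t) (i : Fin t) :
    sumSqDegree (extend f i.castSucc) = sumSqDegree f + 2 * degree (attachGraph f) i + 2 := by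
  have h : ∀ s, ((degree (attachGraph f) s : ℝ) + if i = s then 1 else 0) ^ 2 =
      (degree (attachGraph f) s : ℝ) ^ 2 +
        if i = s then 2 * (degree (attachGraph f) s : ℝ) + 1 else 0 := by
    intro s
    split_ifs <;> ring
  simp [sumSqDegree, Fin.sum_univ_castSucc, degree_extend_castSucc, degree_extend_last, h,
    Finset.sum_add_distrib, (Fin.castSucc_lt_last _).ne]
  ring

theorem sumSqDegree_extend_last {t : ℕ} (f : Fin t → Fin t) :
    sumSqDegree (extend f (Fin.last t)) = sumSqDegree f + 4 := by
  simp [sumSqDegree, Fin.sum_univ_castSucc, degree_extend_castSucc, degree_extend_last,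
    (Fin.castSucc_lt_last _).ne']
  norm_num

/-- Choosing a vertex proportionally to its degree turns the increment `2d` into a multiple of the
sum of squares itself, so the recursion closes. -/
theorem attachExpectation_sumSqDegree_succ (t : ℕ) :
    attachExpectation (t + 1) sumSqDegree =
      (1 + 2 / (2 * t + 1)) * attachExpectation t sumSqDegree + (4 * t + 4) / (2 * t + 1) := by
  rw [attachExpectation_succ, ← attachExpectation_mul_add]
  congr 1
  ext f
  have hsum : ∑ s, (degree (attachGraph f) s : ℝ) = 2 * t := by
    exact_mod_cast sum_degree_attachGraph f
  have h : ∑ s : Fin t, (degree (attachGraph f) s : ℝ) / (2 * t + 1) *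
      (sumSqDegree f + 2 * degree (attachGraph f) s + 2) =
      (2 * t * (sumSqDegree f + 2) + 2 * sumSqDegree f) / (2 * t + 1) := by
    calc _ = ∑ s : Fin t, ((sumSqDegree f + 2) / (2 * t + 1) * (degree (attachGraph f) s : ℝ) +
          2 / (2 * t + 1) * (degree (attachGraph f) s : ℝ) ^ 2) :=
          Finset.sum_congr rfl fun s _ => by ring
      _ = (sumSqDegree f + 2) / (2 * t + 1) * (2 * t) + 2 / (2 * t + 1) * sumSqDegree f := by
          rw [Finset.sum_add_distrib, ← Finset.mul_sum, ← Finset.mul_sum, hsum, sumSqDegree]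
      _ = _ := by ring
  simp only [sumSqDegree_extend_castSucc, sumSqDegree_extend_last]
  rw [h]
  field_simp
  ring

/-- The growth factor is `(2t + 3)/(2t + 1)`, so division by `2t + 1` telescopes it away and leaves
increments of at most `2/(t + 1)`. -/
theorem attachExpectation_sumSqDegree_le (t : ℕ) :
    attachExpectation t sumSqDegree ≤ 2 * (2 * t + 1) * (harmonic t : ℝ) := by
  induction t with
  | zero => simp [attachExpectation, sumSqDegree]
  | succ t ih =>
    rw [attachExpectation_sumSqDegree_succ, harmonic_succ]
    push_cast
    have h1 : (1 + 2 / (2 * t + 1) : ℝ) * (2 * (2 * t + 1) * (harmonic t : ℝ)) =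
        2 * (2 * (t + 1) + 1) * harmonic t := by
      field_simp
      ring
    have h2 : (4 * t + 4 : ℝ) / (2 * t + 1) ≤ 2 * (2 * (t + 1) + 1) * ((t : ℝ) + 1)⁻¹ := by
      rw [← div_eq_mul_inv, div_le_div_iff₀ (by positivity) (by positivity)]
      nlinarith [(Nat.cast_nonneg t : (0 : ℝ) ≤ t)]
    have h3 : (1 + 2 / (2 * t + 1) : ℝ) * attachExpectation t sumSqDegree ≤
        (1 + 2 / (2 * t + 1) : ℝ) * (2 * (2 * t + 1) * (harmonic t : ℝ)) := by gcongr
    rw [mul_add]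
    linarith

/-- The number of loops. -/
def loopCount {t : ℕ} (f : Fin t → Fin t) : ℝ := ({e | f e = e}.ncard : ℝ)

theorem loopCount_eq_sum {t : ℕ} (f : Fin t → Fin t) :
    loopCount f = ∑ e, if f e = e then (1 : ℝ) else 0 := by
  rw [loopCount, Finset.sum_boole, ← Set.ncard_coe_finset]
  simp

theorem loopCount_extend {t : ℕ} (f : Fin t → Fin t) (i : Fin (t + 1)) :
    loopCount (extend f i) = loopCount f + if i = Fin.last t then 1 else 0 := by
  rw [loopCount_eq_sum, loopCount_eq_sum, Fin.sum_univ_castSucc]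
  simp [extend, eq_comm]

theorem attachExpectation_loopCount_succ (t : ℕ) :
    attachExpectation (t + 1) loopCount = attachExpectation t loopCount + 1 / (2 * t + 1) := by
  rw [← one_mul (attachExpectation t loopCount), attachExpectation_succ,
    ← attachExpectation_mul_add]
  congr 1
  ext f
  have hsum : ∑ s, (degree (attachGraph f) s : ℝ) = 2 * t := by
    exact_mod_cast sum_degree_attachGraph f
  simp only [loopCount_extend, (Fin.castSucc_lt_last _).ne, if_false, if_true, add_zero]
  rw [← Finset.sum_mul, ← Finset.sum_div, hsum]
  field_simp
  ring

theorem attachExpectation_loopCount_le (t : ℕ) :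
    attachExpectation t loopCount ≤ (harmonic t : ℝ) := by
  induction t with
  | zero => simp [attachExpectation, loopCount_eq_sum]
  | succ t ih =>
    rw [attachExpectation_loopCount_succ, harmonic_succ]
    push_cast
    rw [← one_div]
    gcongr
    linarith [(Nat.cast_nonneg t : (0 : ℝ) ≤ t)]

/-- The type of `f` allows edges to later vertices; only the support of the law excludes them. -/
theorem le_of_mem_support_attachLaw {t : ℕ} {f : Fin t → Fin t} (hf : f ∈ (attachLaw t).support)
    (e : Fin t) : f e ≤ e := by
  induction t with
  | zero => exact e.elim0
  | succ t ih =>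
    rw [attachLaw, PMF.mem_support_bind_iff] at hf
    obtain ⟨g, hg, hf⟩ := hf
    rw [PMF.mem_support_map_iff] at hf
    obtain ⟨i, -, rfl⟩ := hf
    induction e using Fin.lastCases with
    | last => exact Fin.le_last _
    | cast e => simpa [extend] using ih hg e

/-- Markov's inequality. -/
theorem toOuterMeasure_lt_le {t : ℕ} {φ : (Fin t → Fin t) → ℝ} (hφ : ∀ f, 0 ≤ φ f) {c : ℝ}
    (hc : 0 < c) :
    (attachLaw t).toOuterMeasure {f | c < φ f} ≤ ENNReal.ofReal (attachExpectation t φ / c) := by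
  classical
  rw [PMF.toOuterMeasure_apply_fintype, attachExpectation, Finset.sum_div,
    ENNReal.ofReal_sum_of_nonneg fun f _ =>
      div_nonneg (mul_nonneg ENNReal.toReal_nonneg (hφ f)) hc.le]
  refine Finset.sum_le_sum fun f _ => ?_
  rw [Set.indicator_apply]
  split_ifs with h
  · conv_lhs => rw [← ENNReal.ofReal_toReal ((attachLaw t).apply_ne_top f)]
    refine ENNReal.ofReal_le_ofReal ?_
    rw [le_div_iff₀ hc]
    exact mul_le_mul_of_nonneg_left (le_of_lt h) ENNReal.toReal_nonneg
  · exact zero_le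

theorem toOuterMeasure_compl {α : Type*} (P : PMF α) (s : Set α) :
    1 ≤ P.toOuterMeasure s + P.toOuterMeasure sᶜ := by
  have h : P.toOuterMeasure Set.univ = 1 :=
    (P.toOuterMeasure_apply_eq_one_iff Set.univ).2 (Set.subset_univ _)
  rw [← h, ← Set.union_compl_self s]
  exact MeasureTheory.measure_union_le _ _

/-- A power bound for the logarithm. Any exponent below `1/4` would make the failure probability in
Markov's inequality vanish; `1/8` gives the constant `9 = 1 + 8`. -/
theorem harmonic_mul_le {m n : ℕ} (hm : 1 ≤ m) (hn : 1 ≤ n) :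
    (harmonic (n * m) : ℝ) ≤ 9 * m * (n : ℝ) ^ (1 / 8 : ℝ) := by
  have hm' : (1 : ℝ) ≤ m := by exact_mod_cast hm
  have hn' : (1 : ℝ) ≤ n := by exact_mod_cast hn
  have hmn : (1 : ℝ) ≤ n * m := by nlinarith
  have h1 := harmonic_le_one_add_log (n * m)
  have h2 : Real.log ((n * m : ℕ) : ℝ) ≤ ((n * m : ℕ) : ℝ) ^ (1 / 8 : ℝ) / (1 / 8) :=
    Real.log_le_rpow_div (Nat.cast_nonneg _) (by norm_num)
  push_cast at h1 h2
  have h3 : (1 : ℝ) ≤ ((n : ℝ) * m) ^ (1 / 8 : ℝ) := Real.one_le_rpow hmn (by norm_num)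
  have h4 : ((n : ℝ) * m) ^ (1 / 8 : ℝ) ≤ m * (n : ℝ) ^ (1 / 8 : ℝ) := by
    rw [Real.mul_rpow (by positivity) (by positivity), mul_comm]
    gcongr
    calc (m : ℝ) ^ (1 / 8 : ℝ) ≤ (m : ℝ) ^ (1 : ℝ) :=
          Real.rpow_le_rpow_of_exponent_le hm' (by norm_num)
      _ = m := Real.rpow_one _
  linarith

end Moments

/-! ### Modularity of the preferential attachment graph -/

section Main

variable {m n : ℕ}

theorem toOuterMeasure_sumSqDegree_loopCount (hm : 1 ≤ m) (hn : 1 ≤ n) :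
    1 - ENNReal.ofReal (63 * m ^ 2 * (n : ℝ) ^ (-(1 / 8) : ℝ)) ≤
      (attachLaw (n * m)).toOuterMeasure
        {f | sumSqDegree f ≤ (n : ℝ) ^ (5 / 4 : ℝ) ∧ loopCount f ≤ (n : ℝ) ^ (3 / 4 : ℝ)} := by
  have hm' : (1 : ℝ) ≤ m := by exact_mod_cast hm
  have hn' : (1 : ℝ) ≤ n := by exact_mod_cast hn
  have hn0 : (0 : ℝ) < n := by linarith
  have hmn : (1 : ℝ) ≤ n * m := by nlinarith
  rw [tsub_le_iff_right]
  refine (toOuterMeasure_compl _ _).trans (add_le_add_right ?_ _)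
  have hH := harmonic_mul_le hm hn
  have hH0 : (0 : ℝ) ≤ (harmonic (n * m) : ℝ) := by
    rw [harmonic]
    positivity
  have hS : attachExpectation (n * m) sumSqDegree / (n : ℝ) ^ (5 / 4 : ℝ) ≤
      54 * m ^ 2 * (n : ℝ) ^ (-(1 / 8) : ℝ) := by
    rw [div_le_iff₀ (by positivity)]
    have h1 : (n : ℝ) ^ (-(1 / 8) : ℝ) * (n : ℝ) ^ (5 / 4 : ℝ) = n * (n : ℝ) ^ (1 / 8 : ℝ) := by
      rw [← Real.rpow_add hn0]
      nth_rw 2 [← Real.rpow_one (n : ℝ)]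
      rw [← Real.rpow_add hn0]
      norm_num
    calc attachExpectation (n * m) sumSqDegree
        ≤ 2 * (2 * (n * m : ℕ) + 1) * (harmonic (n * m) : ℝ) := attachExpectation_sumSqDegree_le _
      _ ≤ 2 * (3 * (n * m)) * (9 * m * (n : ℝ) ^ (1 / 8 : ℝ)) := by
          push_cast
          gcongr
          linarith
      _ = 54 * m ^ 2 * (n * (n : ℝ) ^ (1 / 8 : ℝ)) := by ring
      _ = _ := by rw [← h1]; ring
  have hL : attachExpectation (n * m) loopCount / (n : ℝ) ^ (3 / 4 : ℝ) ≤
      9 * m ^ 2 * (n : ℝ) ^ (-(1 / 8) : ℝ) := by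
    rw [div_le_iff₀ (by positivity), mul_assoc, ← Real.rpow_add hn0]
    calc attachExpectation (n * m) loopCount
        ≤ (harmonic (n * m) : ℝ) := attachExpectation_loopCount_le _
      _ ≤ 9 * m * (n : ℝ) ^ (1 / 8 : ℝ) := hH
      _ ≤ _ := by
          gcongr
          · nlinarith
          · norm_num
  calc _ ≤ (attachLaw (n * m)).toOuterMeasure ({f | (n : ℝ) ^ (5 / 4 : ℝ) < sumSqDegree f} ∪
        {f | (n : ℝ) ^ (3 / 4 : ℝ) < loopCount f}) := by
        refine MeasureTheory.measure_mono fun f hf => ?_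
        simp only [Set.mem_compl_iff, Set.mem_ofPred_eq, not_and_or, not_le] at hf
        exact hf
    _ ≤ _ := MeasureTheory.measure_union_le _ _
    _ ≤ ENNReal.ofReal (54 * m ^ 2 * (n : ℝ) ^ (-(1 / 8) : ℝ)) +
          ENNReal.ofReal (9 * m ^ 2 * (n : ℝ) ^ (-(1 / 8) : ℝ)) :=
        add_le_add
          ((toOuterMeasure_lt_le sumSqDegree_nonneg (by positivity)).trans
            (ENNReal.ofReal_le_ofReal hS))
          ((toOuterMeasure_lt_le (fun _ => Nat.cast_nonneg _) (by positivity)).trans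
            (ENNReal.ofReal_le_ofReal hL))
    _ = _ := by
        rw [← ENNReal.ofReal_add (by positivity) (by positivity)]
        congr 1
        ring

/-- The choice of the threshold `⌈n ^ (1 / 4)⌉` for the weight of the pieces. -/
theorem one_div_sub_le {S L : ℝ} {x : ℕ} (hm : 1 ≤ m) (hn : 1 ≤ n)
    (hx : x = ⌈(n : ℝ) ^ (1 / 4 : ℝ)⌉₊) (hn2 : 2 ≤ (n : ℝ) ^ (1 / 4 : ℝ))
    (hS0 : 0 ≤ S) (hS : S ≤ (n : ℝ) ^ (5 / 4 : ℝ)) (hL : L ≤ (n : ℝ) ^ (3 / 4 : ℝ)) :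
    1 / (m : ℝ) - (3 + 4 * m) * (n : ℝ) ^ (-(1 / 4) : ℝ) ≤
      1 / (m : ℝ) - L / (n * m : ℝ) - 2 / x - (1 + x : ℝ) ^ 2 * (m * S) / (n : ℝ) ^ 2 := by
  have hm' : (1 : ℝ) ≤ m := by exact_mod_cast hm
  have hn0 : (0 : ℝ) ≤ n := Nat.cast_nonneg n
  set y := (n : ℝ) ^ (1 / 4 : ℝ) with hy
  have hy4 : (n : ℝ) = y ^ 4 := by
    rw [hy, ← Real.rpow_mul_natCast hn0]
    norm_num
  have hy5 : (n : ℝ) ^ (5 / 4 : ℝ) = y ^ 5 := by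
    rw [hy, ← Real.rpow_mul_natCast hn0]
    norm_num
  have hy3 : (n : ℝ) ^ (3 / 4 : ℝ) = y ^ 3 := by
    rw [hy, ← Real.rpow_mul_natCast hn0]
    norm_num
  have hyi : (n : ℝ) ^ (-(1 / 4) : ℝ) = 1 / y := by
    rw [Real.rpow_neg hn0, one_div y]
  rw [hy5] at hS
  rw [hy3] at hL
  have hy0 : 0 < y := by linarith
  have hx1 : y ≤ x := hx ▸ Nat.le_ceil y
  have hx2 : (x : ℝ) ≤ y + 1 := hx ▸ (Nat.ceil_lt_add_one hy0.le).le
  have h1 : L / (n * m : ℝ) ≤ 1 / y := by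
    rw [hy4]
    calc L / (y ^ 4 * m) ≤ y ^ 3 / (y ^ 4 * 1) := by gcongr
      _ = 1 / y := by field_simp
  have h2 : (2 : ℝ) / x ≤ 2 / y := by gcongr
  have h3 : (1 + x : ℝ) ^ 2 * (m * S) / (n : ℝ) ^ 2 ≤ 4 * m / y := by
    rw [hy4]
    -- Here `1 + x ≤ y + 2 ≤ 2y`, by rounding up and `y ≥ 2`.
    calc (1 + x : ℝ) ^ 2 * (m * S) / (y ^ 4) ^ 2
        ≤ (2 * y) ^ 2 * (m * y ^ 5) / (y ^ 4) ^ 2 := by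
          gcongr
          linarith
      _ = 4 * m / y := by
          field_simp
          ring
  rw [hyi]
  have h4 : (3 + 4 * (m : ℝ)) * (1 / y) = 1 / y + 2 / y + 4 * m / y := by ring
  linarith

theorem le_toOuterMeasure_prefAttachGraph (hm : 1 ≤ m) (hn : 16 ≤ n) :
    1 - ENNReal.ofReal (63 * m ^ 2 * (n : ℝ) ^ (-(1 / 8) : ℝ)) ≤
      (prefAttachGraph m n).toOuterMeasure
        {G | 1 / (m : ℝ) - (3 + 4 * m) * (n : ℝ) ^ (-(1 / 4) : ℝ) ≤ modularity G ∧
          1 / (m : ℝ) - (3 + 4 * m) * (n : ℝ) ^ (-(1 / 4) : ℝ) ≤ modularity (simplify G)} := by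
  have hn1 : 1 ≤ n := by omega
  refine (toOuterMeasure_sumSqDegree_loopCount hm hn1).trans ?_
  rw [prefAttachGraph, PMF.toOuterMeasure_map_apply]
  -- Inclusion is needed only on the support, which supplies `f e ≤ e`.
  refine PMF.toOuterMeasure_mono _ ?_
  rintro f ⟨⟨hS, hL⟩, hf⟩
  have hf' := le_of_mem_support_attachLaw hf
  have hn0 : (0 : ℝ) ≤ n := Nat.cast_nonneg n
  have hn2 : 2 ≤ (n : ℝ) ^ (1 / 4 : ℝ) := by
    calc (2 : ℝ) = (16 : ℝ) ^ (1 / 4 : ℝ) := by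
          rw [show (16 : ℝ) = 2 ^ (4 : ℝ) by norm_num, ← Real.rpow_mul (by norm_num)]
          norm_num
      _ ≤ (n : ℝ) ^ (1 / 4 : ℝ) := by
          gcongr
          exact_mod_cast hn
  -- Since `n^(1/4) ≥ 2`, twice the loop bound `n^(3/4)` is at most `n`.
  have hloops : 2 * {e | f e = e}.ncard ≤ n := by
    have h1 : (n : ℝ) ^ (1 / 4 : ℝ) * (n : ℝ) ^ (3 / 4 : ℝ) = n := by
      rw [← Real.rpow_add (by exact_mod_cast hn1)]
      norm_num
    have h2 : 0 ≤ (n : ℝ) ^ (3 / 4 : ℝ) := by positivity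
    have h3 : 2 * loopCount f ≤ n := by nlinarith
    rw [loopCount] at h3
    exact_mod_cast h3
  have hx : 0 < ⌈(n : ℝ) ^ (1 / 4 : ℝ)⌉₊ := Nat.ceil_pos.2 (by linarith)
  have h := one_div_sub_le hm hn1 rfl hn2 (sumSqDegree_nonneg f) hS hL
  exact ⟨h.trans (le_modularity_map_attachGraph hm hf' hn1 hloops hx),
    h.trans (le_modularity_simplify_map_attachGraph hm hf' hn1 hloops hx)⟩

theorem aas_of_le {m : ℕ} (hm : 1 ≤ m) (δ : ℕ → ℝ)
    (hδ : ∀ n : ℕ, 1 ≤ n → (3 + 4 * m) * (n : ℝ) ^ (-(1 / 4) : ℝ) ≤ δ n) :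
    AAS (prefAttachGraph m) fun n =>
      {G | 1 / (m : ℝ) - δ n ≤ modularity G ∧ 1 / (m : ℝ) - δ n ≤ modularity (simplify G)} := by
  have hlim : Tendsto (fun n : ℕ => 1 - ENNReal.ofReal (63 * m ^ 2 * (n : ℝ) ^ (-(1 / 8) : ℝ)))
      atTop (𝓝 1) := by
    have h1 : Tendsto (fun n : ℕ => 63 * (m : ℝ) ^ 2 * (n : ℝ) ^ (-(1 / 8) : ℝ)) atTop (𝓝 0) := by
      have := ((tendsto_rpow_neg_atTop (show (0 : ℝ) < 1 / 8 by norm_num)).comp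
        tendsto_natCast_atTop_atTop).const_mul (63 * (m : ℝ) ^ 2)
      simpa using this
    have h2 := ENNReal.tendsto_ofReal h1
    rw [ENNReal.ofReal_zero] at h2
    simpa using ENNReal.Tendsto.sub (tendsto_const_nhds (x := (1 : ℝ≥0∞))) h2
      (Or.inl ENNReal.one_ne_top)
  refine tendsto_of_tendsto_of_tendsto_of_le_of_le' hlim tendsto_const_nhds ?_ ?_
  · filter_upwards [eventually_ge_atTop 16] with n hn
    refine (le_toOuterMeasure_prefAttachGraph hm hn).trans (MeasureTheory.measure_mono ?_)
    have := hδ n (by omega)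
    rintro G ⟨h1, h2⟩
    exact ⟨by linarith, by linarith⟩
  · refine Eventually.of_forall fun n => ?_
    calc _ ≤ (prefAttachGraph m n).toOuterMeasure Set.univ :=
          MeasureTheory.measure_mono (Set.subset_univ _)
      _ = 1 := (PMF.toOuterMeasure_apply_eq_one_iff _ _).2 (Set.subset_univ _)

end Main

end PrefAttach

end

theorem mainTheorem5 (m : ℕ) (hm : 1 ≤ m) :
    (∀ ε : ℝ, 0 < ε → ∃ C : ℝ,
      PrefAttach.AAS (PrefAttach.prefAttachGraph m) fun n =>
        {G | 1 / (m : ℝ) - C * (n : ℝ) ^ (-(1 / 4 : ℝ) + ε) ≤ PrefAttach.modularity G ∧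
          1 / (m : ℝ) - C * (n : ℝ) ^ (-(1 / 4 : ℝ) + ε) ≤
            PrefAttach.modularity (PrefAttach.simplify G)}) ∧
    (∃ δ : ℕ → ℝ, Tendsto δ atTop (𝓝 0) ∧
      PrefAttach.AAS (PrefAttach.prefAttachGraph m) fun n =>
        {G | 1 / (m : ℝ) - δ n ≤ PrefAttach.modularity G ∧
          1 / (m : ℝ) - δ n ≤ PrefAttach.modularity (PrefAttach.simplify G)}) := by
  -- The rate `n^(-1/4)` is already attained, so one `C` serves every `ε`, and the same bound is the
  -- sequence `δ`.
  refine ⟨fun ε hε => ⟨3 + 4 * m, PrefAttach.aas_of_le hm _ fun n hn => ?_⟩,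
    fun n => (3 + 4 * m) * (n : ℝ) ^ (-(1 / 4) : ℝ), ?_,
    PrefAttach.aas_of_le hm _ fun n _ => le_rfl⟩
  · gcongr
    · exact_mod_cast hn
    · linarith
  · have := ((tendsto_rpow_neg_atTop (show (0 : ℝ) < 1 / 4 by norm_num)).comp
      tendsto_natCast_atTop_atTop).const_mul (3 + 4 * (m : ℝ))
    simpa using this
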